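/- Let $n\ge 2$, $0<\sigma<1$, $\rho>0$, and let $S\subset\mathbb{R}^n$ be the sphere of radius $\rho$ with center $c$, oriented by its outward unit normal $\mathbf n(z)=(z-c)/\rho$. For $z\in S$ let $T_zS=\mathbf n(z)^{\perp}$ be the tangent space. Let $\mathcal X(S)$ be the set of pairs $(x,y)\in\mathbb{R}^n\times\mathbb{R}^n$ such that the segment joining $x$ and $y$ crosses $S$ an odd number of times (only points of $S$ strictly between $x$ and $y$ are counted). Put $\widehat\chi_S(z,y)=1$ if either $(z,y)\notin\mathcal X(S)$ and $(z-y)\cdot\mathbf n(z)>0$, or $(z,y)\in\mathcal X(S)$ and $(z-y)\cdot\mathbf n(z)<0$; put $\widehat\chi_S(z,y)=-1$ if either $(z,y)\in\mathcal X(S)$ and $(z-y)\cdot\mathbf n(z)>0$, or $(z,y)\notin\mathcal X(S)$ and $(z-y)\cdot\mathbf n(z)<0$; and $\widehat\chi_S(z,y)=0$ otherwise. For a unit vector $e\in T_zS$ let $\pi(z,e)=\{z+te+h\,\mathbf n(z): t>0,\ h\in\mathbb{R}\}$, and for $y\in\pi(z,e)$ let $y'$ be the orthogonal projection of $y$ onto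 the line through $z$ in the direction $e$. The nonlocal directional curvature at $z$ in the direction $e$ is the principal value $$k_{\sigma,e}(z)=\lim_{\varepsilon\to0^+}\int_{\pi(z,e)\setminus B_\varepsilon(z)}\frac{|z-y'|^{n-2}\,\widehat\chi_S(z,y)}{|z-y|^{n+\sigma}}\,dy ,$$ where $dy$ is the area measure of the half-plane, and the nonlocal curvature tensor is the linear operator on $T_zS$ $$L_\sigma(z)=\frac{n-1}{(1+\sigma)\,\omega_{n-2}}\int_{\{e\in T_zS:\,|e|=1\}}k_{\sigma,e}(z)\big((n+\sigma)\,e\otimes e-\mathbf 1_{T_zS}\big)\,de ,$$ where $de$ is the surface measure on the unit sphere of $T_zS$ (counting measure if $n=2$) and $\omega_{n-2}$ is the measure of the unit sphere in $\mathbb{R}^{n-1}$. Then, for every $z\in S$ and every unit vector $e\in T_zS$, the integrals over $\pi(z,e)\setminus B_\varepsilon(z)$ converge absolutely for all $\varepsilon>0$, the limit exists, and $$k_{\sigma,e}(z)=-\frac{B\!\left(\tfrac{1-\sigma}{2},\tfrac{n-1}{2}\right)}{\sigma\,(2\rho)^{\sigma}} ,$$ where $B$ is the Euler beta function. Consequently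 the integral defining $L_\sigma(z)$ converges absolutely and $$L_\sigma(z)=-\frac{B\!\left(\tfrac{1-\sigma}{2},\tfrac{n-1}{2}\right)}{\sigma\,(2\rho)^{\sigma}}\;\mathbf 1_{T_zS}.$$ -/

import Mathlib

open MeasureTheory Metric Filter Topology Set
open scoped RealInnerProductSpace

noncomputable section

namespace NonlocalCurvature

section Sphere

variable (F : Type*) [NormedAddCommGroup F] [InnerProductSpace ℝ F]
  [FiniteDimensional ℝ F] [MeasurableSpace F] [BorelSpace F]

/-- The standard surface measure on the unit sphere of a finite-dimensional Euclidean space `F`,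
induced by the Lebesgue measure of `F`. In dimension one it is the counting measure on the two
unit vectors. -/
def unitSphereMeasure : Measure (sphere (0 : F) 1) :=
  (volume : Measure F).toSphere

/-- The operator `k(e) (a e ⊗ e - 1)` on `F`, for a unit vector `e`. -/
def sphereIntegrand (a : ℝ) (k : sphere (0 : F) 1 → ℝ) (e : sphere (0 : F) 1) : F →L[ℝ] F :=
  k e • (a • InnerProductSpace.rankOne ℝ (e : F) (e : F) - ContinuousLinearMap.id ℝ F)

/-- The integral of `k(e) (a e ⊗ e - 1)` over the unit vectors `e` converges absolutely. -/
def SphereIntegrable (a : ℝ) (k : sphere (0 : F) 1 → ℝ) : Prop :=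
  Integrable (sphereIntegrand F a k) (unitSphereMeasure F)

/-- The integral of `k(e) (a e ⊗ e - 1)` over the unit vectors `e` of `F`. -/
def sphereIntegral (a : ℝ) (k : sphere (0 : F) 1 → ℝ) : F →L[ℝ] F :=
  ∫ e, sphereIntegrand F a k e ∂(unitSphereMeasure F)

end Sphere

/-- `omega d` is the `(d - 1)`-dimensional measure of the unit sphere of `ℝ^d`. -/
def omega (d : ℕ) : ℝ :=
  (unitSphereMeasure (EuclideanSpace ℝ (Fin d))).real univ

variable {n : ℕ}

/-- The pairs `(x, y)` such that the segment from `x` to `y` crosses `S` an odd number of times.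
End points are not crossings: only points strictly between `x` and `y` are counted. -/
def oddCrossing (S : Set (EuclideanSpace ℝ (Fin n))) :
    Set (EuclideanSpace ℝ (Fin n) × EuclideanSpace ℝ (Fin n)) :=
  {p | (openSegment ℝ p.1 p.2 ∩ S).Finite ∧ Odd (openSegment ℝ p.1 p.2 ∩ S).ncard}

/-- The set `𝒜_e(z)` of an oriented hypersurface `S` with unit normal field `ν`. -/
def exteriorSet (S : Set (EuclideanSpace ℝ (Fin n)))
    (ν : EuclideanSpace ℝ (Fin n) → EuclideanSpace ℝ (Fin n)) (z : EuclideanSpace ℝ (Fin n)) :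
    Set (EuclideanSpace ℝ (Fin n)) :=
  {y | ((z, y) ∈ oddCrossing S ∧ 0 < ⟪z - y, ν z⟫) ∨
    ((z, y) ∉ oddCrossing S ∧ ⟪z - y, ν z⟫ < 0)}

/-- The set `𝒜_i(z)` of an oriented hypersurface `S` with unit normal field `ν`. -/
def interiorSet (S : Set (EuclideanSpace ℝ (Fin n)))
    (ν : EuclideanSpace ℝ (Fin n) → EuclideanSpace ℝ (Fin n)) (z : EuclideanSpace ℝ (Fin n)) :
    Set (EuclideanSpace ℝ (Fin n)) :=
  {y | ((z, y) ∉ oddCrossing S ∧ 0 < ⟪z - y, ν z⟫) ∨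
    ((z, y) ∈ oddCrossing S ∧ ⟪z - y, ν z⟫ < 0)}

open Classical in
/-- The function `χ̂_S(z, y)`: `1` on `𝒜_i(z)`, `-1` on `𝒜_e(z)`, and `0` elsewhere. -/
def chiHat (S : Set (EuclideanSpace ℝ (Fin n)))
    (ν : EuclideanSpace ℝ (Fin n) → EuclideanSpace ℝ (Fin n)) (z y : EuclideanSpace ℝ (Fin n)) :
    ℝ :=
  if y ∈ interiorSet S ν z then 1 else if y ∈ exteriorSet S ν z then -1 else 0

/-- The tangent space at `z` of a hypersurface with unit normal field `ν`. -/
abbrev tangentSpace (ν : EuclideanSpace ℝ (Fin n) → EuclideanSpace ℝ (Fin n))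
    (z : EuclideanSpace ℝ (Fin n)) : Submodule ℝ (EuclideanSpace ℝ (Fin n)) :=
  (Submodule.span ℝ {ν z})ᗮ

/-- The open half-plane `π(z, e)` bounded by the normal line at `z`, in the direction `e`. -/
def halfPlane (ν : EuclideanSpace ℝ (Fin n) → EuclideanSpace ℝ (Fin n))
    (z e : EuclideanSpace ℝ (Fin n)) : Set (EuclideanSpace ℝ (Fin n)) :=
  {y | ∃ t h : ℝ, 0 < t ∧ y = z + t • e + h • ν z}

/-- The orthogonal projection `y'` of `y` onto the line through `z` in the direction `e`. -/
def lineProj (z e y : EuclideanSpace ℝ (Fin n)) : EuclideanSpace ℝ (Fin n) :=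
  z + (Submodule.span ℝ {e}).starProjection (y - z)

/-- The integrand `|z - y'|^(n-2) χ̂_S(z, y) / |z - y|^(n+σ)` of the directional curvature. -/
def directionalIntegrand (S : Set (EuclideanSpace ℝ (Fin n)))
    (ν : EuclideanSpace ℝ (Fin n) → EuclideanSpace ℝ (Fin n)) (σ : ℝ)
    (z e y : EuclideanSpace ℝ (Fin n)) : ℝ :=
  ‖z - lineProj z e y‖ ^ ((n : ℝ) - 2) * chiHat S ν z y / ‖z - y‖ ^ ((n : ℝ) + σ)

/-- The integral over `π(z, e) \ B_ε(z)`, with respect to the area measure of the half-plane. -/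
def truncatedDirectionalCurvature (S : Set (EuclideanSpace ℝ (Fin n)))
    (ν : EuclideanSpace ℝ (Fin n) → EuclideanSpace ℝ (Fin n)) (σ : ℝ)
    (z e : EuclideanSpace ℝ (Fin n)) (ε : ℝ) : ℝ :=
  ∫ y in halfPlane ν z e \ ball z ε, directionalIntegrand S ν σ z e y
    ∂(Measure.euclideanHausdorffMeasure 2)

/-- The principal value defining the nonlocal directional curvature exists and equals `k`. -/
def HasNonlocalDirectionalCurvature (S : Set (EuclideanSpace ℝ (Fin n)))
    (ν : EuclideanSpace ℝ (Fin n) → EuclideanSpace ℝ (Fin n)) (σ : ℝ)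
    (z e : EuclideanSpace ℝ (Fin n)) (k : ℝ) : Prop :=
  (∀ ε : ℝ, 0 < ε → IntegrableOn (directionalIntegrand S ν σ z e) (halfPlane ν z e \ ball z ε)
    (Measure.euclideanHausdorffMeasure 2)) ∧
  Tendsto (truncatedDirectionalCurvature S ν σ z e) (𝓝[>] 0) (𝓝 k)

/-- The nonlocal directional curvature `k_{σ,e}(z)`, the principal value of the integral over
`π(z, e)`. -/
def nonlocalDirectionalCurvature (S : Set (EuclideanSpace ℝ (Fin n)))
    (ν : EuclideanSpace ℝ (Fin n) → EuclideanSpace ℝ (Fin n)) (σ : ℝ)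
    (z e : EuclideanSpace ℝ (Fin n)) : ℝ :=
  limUnder (𝓝[>] 0) (truncatedDirectionalCurvature S ν σ z e)

/-- The nonlocal directional curvature as a function of the unit tangent vector. -/
def tangentialCurvature (S : Set (EuclideanSpace ℝ (Fin n)))
    (ν : EuclideanSpace ℝ (Fin n) → EuclideanSpace ℝ (Fin n)) (σ : ℝ)
    (z : EuclideanSpace ℝ (Fin n)) (e : sphere (0 : tangentSpace ν z) 1) : ℝ :=
  nonlocalDirectionalCurvature S ν σ z ((e : tangentSpace ν z) : EuclideanSpace ℝ (Fin n))

/-- The integrand `k_{σ,e}(z) ((n + σ) e ⊗ e - 1)` of the nonlocal curvature tensor converges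
absolutely over the unit tangent vectors `e`. -/
def TensorIntegrable (S : Set (EuclideanSpace ℝ (Fin n)))
    (ν : EuclideanSpace ℝ (Fin n) → EuclideanSpace ℝ (Fin n)) (σ : ℝ)
    (z : EuclideanSpace ℝ (Fin n)) : Prop :=
  SphereIntegrable (tangentSpace ν z) ((n : ℝ) + σ) (tangentialCurvature S ν σ z)

/-- The nonlocal curvature tensor `L_σ(z)`, a linear operator on the tangent space at `z`:
`(n - 1) / ((1 + σ) ω_{n-2}) * ∫ k_{σ,e}(z) ((n + σ) e ⊗ e - 1) de` over the unit tangent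
vectors `e`. -/
def nonlocalCurvatureTensor (S : Set (EuclideanSpace ℝ (Fin n)))
    (ν : EuclideanSpace ℝ (Fin n) → EuclideanSpace ℝ (Fin n)) (σ : ℝ)
    (z : EuclideanSpace ℝ (Fin n)) : tangentSpace ν z →L[ℝ] tangentSpace ν z :=
  (((n : ℝ) - 1) / ((1 + σ) * omega (n - 1))) •
    sphereIntegral (tangentSpace ν z) ((n : ℝ) + σ) (tangentialCurvature S ν σ z)

/-- The outward unit normal field of the sphere of center `c` and radius `ρ`. -/
def sphereNormal (c : EuclideanSpace ℝ (Fin n)) (ρ : ℝ) (z : EuclideanSpace ℝ (Fin n)) :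
    EuclideanSpace ℝ (Fin n) :=
  ρ⁻¹ • (z - c)

end NonlocalCurvature

end

/-
Parametrize the half-plane `π(z, e)` by `w = t + i h` with `t > 0`. The segment from `z` to
`z + t e + h n` crosses `S` exactly when `h < 0` and the end point lies outside the disc of radius
`ρ` tangent to the line `h = 0` from below, so `χ̂` is `1` on that disc and `-1` off it. Averaging
over the reflection `h ↦ -h` cancels the disc against its mirror image, and only the exterior of
both discs survives, with weight `-1`. In polar coordinates it is `r > 2 ρ |sin θ|`, where the
kernel `r ^ (-2 - σ) cos ^ (n - 2) θ` is integrable for `r dr dθ` exactly because `σ < 1`: the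
principal value is an absolutely convergent integral, which the substitution `x = sin ^ 2 θ` turns
into a beta function. The curvature is the same in all directions, so the tensor follows from the
moment identity `d ∫ e ⊗ e = ω 1` on the unit sphere in dimension `d`, where `d = n - 1` and
`(n + σ) - d = 1 + σ`.
-/

namespace NonlocalCurvature

section Beta

open ProbabilityTheory Real

theorem integral_rpow_mul_one_sub_rpow {a b : ℝ} (ha : 0 < a) (hb : 0 < b) :
    ∫ x in Ioo (0 : ℝ) 1, x ^ (a - 1) * (1 - x) ^ (b - 1) = beta a b := by
  have hbeta : 0 < beta a b := beta_pos ha hb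
  have hnonneg : 0 ≤ᵐ[volume.restrict (Ioo 0 1)]
      fun x : ℝ => 1 / beta a b * x ^ (a - 1) * (1 - x) ^ (b - 1) := by
    filter_upwards [ae_restrict_mem measurableSet_Ioo] with x hx
    have hx₀ : 0 < x := hx.1
    have hx₁ : 0 < 1 - x := sub_pos.2 hx.2
    simp only [Pi.zero_apply]
    positivity
  have hone : ∫ x in Ioo (0 : ℝ) 1, 1 / beta a b * x ^ (a - 1) * (1 - x) ^ (b - 1) = 1 := by
    rw [integral_eq_lintegral_of_nonneg_ae hnonneg (by fun_prop), ← lintegral_betaPDF,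
      lintegral_betaPDF_eq_one ha hb, ENNReal.toReal_one]
  simp_rw [mul_assoc, integral_const_mul] at hone
  field_simp at hone
  exact hone

theorem sin_pos_and_cos_pos {θ : ℝ} (hθ : θ ∈ Ioo 0 (π / 2)) : 0 < sin θ ∧ 0 < cos θ :=
  ⟨sin_pos_of_pos_of_lt_pi hθ.1 (by linarith [hθ.2, pi_pos]),
    cos_pos_of_mem_Ioo ⟨by linarith [hθ.1, pi_pos], hθ.2⟩⟩

theorem image_sin_sq_Ioo : (fun θ : ℝ => sin θ ^ 2) '' Ioo 0 (π / 2) = Ioo 0 1 := by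
  ext x
  constructor
  · rintro ⟨θ, hθ, rfl⟩
    obtain ⟨hs, hc⟩ := sin_pos_and_cos_pos hθ
    exact ⟨by positivity, by simp only; nlinarith [sin_sq_add_cos_sq θ]⟩
  · intro hx
    have h₀ : 0 < √x := sqrt_pos.2 hx.1
    have h₁ : √x < 1 := by rw [sqrt_lt' one_pos, one_pow]; exact hx.2
    refine ⟨arcsin √x, ⟨arcsin_pos.2 h₀, arcsin_lt_pi_div_two.2 h₁⟩, ?_⟩
    simp only [sin_arcsin (by linarith) h₁.le, sq_sqrt hx.1.le]

theorem injOn_sin_sq : InjOn (fun θ : ℝ => sin θ ^ 2) (Ioo 0 (π / 2)) := by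
  intro x hx y hy hxy
  have hsin : sin x = sin y :=
    (sq_eq_sq₀ (sin_pos_and_cos_pos hx).1.le (sin_pos_and_cos_pos hy).1.le).1 hxy
  exact injOn_sin ⟨by linarith [hx.1, pi_pos], hx.2.le⟩ ⟨by linarith [hy.1, pi_pos], hy.2.le⟩ hsin

theorem hasDerivAt_sin_sq (θ : ℝ) :
    HasDerivAt (fun θ : ℝ => sin θ ^ 2) (2 * sin θ * cos θ) θ := by
  simpa using (hasDerivAt_sin θ).fun_pow 2

theorem two_mul_integral_sin_rpow_mul_cos_rpow {a b : ℝ} (ha : 0 < a) (hb : 0 < b) :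
    2 * ∫ θ in Ioo 0 (π / 2), sin θ ^ (2 * a - 1) * cos θ ^ (2 * b - 1) = beta a b := by
  rw [← integral_rpow_mul_one_sub_rpow ha hb, ← image_sin_sq_Ioo,
    integral_image_eq_integral_abs_deriv_smul measurableSet_Ioo
    (fun θ _ => (hasDerivAt_sin_sq θ).hasDerivWithinAt) injOn_sin_sq, ← integral_const_mul]
  refine setIntegral_congr_fun measurableSet_Ioo fun θ hθ => ?_
  obtain ⟨hs, hc⟩ := sin_pos_and_cos_pos hθ
  have double_exponent {x : ℝ} (hx : 0 < x) (c : ℝ) : x ^ (2 * c - 1) = x * (x ^ 2) ^ (c - 1) := by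
    rw [show 2 * c - 1 = 1 + (2 : ℕ) * (c - 1) by push_cast; ring, rpow_add hx, rpow_one,
      rpow_natCast_mul hx.le]
  simp only [double_exponent hs, double_exponent hc, ← cos_sq', smul_eq_mul]
  rw [abs_of_pos (by positivity)]
  ring

theorem integral_abs_sin_rpow_mul_cos_rpow {a b : ℝ} (ha : 0 < a) (hb : 0 < b) :
    ∫ θ in Ioo (-(π / 2)) (π / 2), |sin θ| ^ (2 * a - 1) * cos θ ^ (2 * b - 1) = beta a b := by
  set f : ℝ → ℝ :=
    (Iio (π / 2)).indicator fun θ => sin θ ^ (2 * a - 1) * cos θ ^ (2 * b - 1) with hf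
  have hsymm : (Ioo (-(π / 2)) (π / 2)).indicator
      (fun θ => |sin θ| ^ (2 * a - 1) * cos θ ^ (2 * b - 1)) = fun θ => f |θ| := by
    ext θ
    by_cases hθ : |θ| < π / 2
    · rw [hf, indicator_of_mem (s := Ioo _ _) (abs_lt.1 hθ),
        indicator_of_mem (mem_Iio.2 hθ), cos_abs,
        abs_sin_eq_sin_abs_of_abs_le_pi (by linarith [pi_pos])]
    · rw [hf, indicator_of_notMem (s := Ioo _ _) (mt abs_lt.2 hθ),
        indicator_of_notMem (mt mem_Iio.1 hθ)]
  rw [← two_mul_integral_sin_rpow_mul_cos_rpow ha hb, ← integral_indicator measurableSet_Ioo,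
    hsymm, integral_comp_abs, hf, setIntegral_indicator measurableSet_Iio, Ioi_inter_Iio]

end Beta

section Polar

open Real

/-- The kernel `t ^ p / |w| ^ (p + 2 + σ)`, `t = re w`: the absolute value of the integrand of the
directional curvature, in a half-plane identified with `{re > 0} ⊆ ℂ` and for `n = p + 2`. -/
noncomputable def planeKernel (p σ : ℝ) (w : ℂ) : ℝ :=
  w.re ^ p / ‖w‖ ^ (p + 2 + σ)

/-- The part of the half-plane `{re > 0}` lying beyond the polar graph `r = a(θ)`: a general
shape for the domains of integration, whose polar slices are half-lines. -/
def radialExterior (a : ℝ → ℝ) : Set ℂ :=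
  {w | 0 < w.re ∧ a w.arg < ‖w‖}

theorem measurable_planeKernel (p σ : ℝ) : Measurable (planeKernel p σ) := by
  unfold planeKernel
  fun_prop

theorem planeKernel_nonneg (p σ : ℝ) {w : ℂ} (hw : 0 ≤ w.re) : 0 ≤ planeKernel p σ w := by
  unfold planeKernel
  positivity

theorem measurableSet_radialExterior {a : ℝ → ℝ} (ha : Measurable a) :
    MeasurableSet (radialExterior a) :=
  (measurableSet_lt measurable_const Complex.measurable_re).inter
    (measurableSet_lt (ha.comp Complex.measurable_arg) measurable_norm)

theorem lintegral_Ioi_rpow {s c : ℝ} (hs : s < -1) (hc : 0 < c) :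
    ∫⁻ r in Ioi c, ENNReal.ofReal (r ^ s) = ENNReal.ofReal (-c ^ (s + 1) / (s + 1)) := by
  have hnonneg : 0 ≤ᵐ[volume.restrict (Ioi c)] fun r => r ^ s := by
    filter_upwards [ae_restrict_mem measurableSet_Ioi] with r hr
    exact rpow_nonneg (hc.le.trans (le_of_lt hr)) s
  rw [← ofReal_integral_eq_lintegral_ofReal (integrableOn_Ioi_rpow_of_lt hs hc) hnonneg,
    integral_Ioi_rpow_of_lt hs hc]

theorem cos_pos_iff_of_mem_Ioo {θ : ℝ} (hθ : θ ∈ Ioo (-π) π) :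
    0 < cos θ ↔ θ ∈ Ioo (-(π / 2)) (π / 2) := by
  refine ⟨fun h => ?_, cos_pos_of_mem_Ioo⟩
  rw [mem_Ioo, ← abs_lt]
  by_contra! hge
  rw [← cos_abs] at h
  exact h.not_ge (cos_nonpos_of_pi_div_two_le_of_le hge (by linarith [abs_lt.2 hθ, pi_pos]))

theorem polarCoord_symm_mem_radialExterior_iff (a : ℝ → ℝ) {q : ℝ × ℝ}
    (hq : q ∈ Ioi (0 : ℝ) ×ˢ Ioo (-π) π) :
    Complex.polarCoord.symm q ∈ radialExterior a ↔
      q.2 ∈ Ioo (-(π / 2)) (π / 2) ∧ a q.2 < q.1 := by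
  obtain ⟨hr, hθ⟩ := hq
  have hre : (Complex.polarCoord.symm q).re = q.1 * cos q.2 := by
    simp [-Complex.ofReal_cos]
  have harg : (Complex.polarCoord.symm q).arg = q.2 := by
    rw [Complex.polarCoord_symm_apply, Complex.ofReal_cos, Complex.ofReal_sin,
      Complex.arg_mul_cos_add_sin_mul_I hr ⟨hθ.1, hθ.2.le⟩]
  rw [radialExterior, mem_ofPred_eq, hre, harg, Complex.norm_polarCoord_symm, abs_of_pos hr,
    mul_pos_iff_of_pos_left hr, cos_pos_iff_of_mem_Ioo hθ]

theorem mul_planeKernel_polarCoord_symm (p σ : ℝ) {q : ℝ × ℝ} (hr : 0 < q.1)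
    (hθ : 0 ≤ cos q.2) :
    q.1 * planeKernel p σ (Complex.polarCoord.symm q) = cos q.2 ^ p * q.1 ^ (-1 - σ) := by
  have hre : (Complex.polarCoord.symm q).re = q.1 * cos q.2 := by
    simp [-Complex.ofReal_cos]
  rw [planeKernel, hre, Complex.norm_polarCoord_symm, abs_of_pos hr, mul_rpow hr.le hθ,
    show -1 - σ = 1 + p - (p + 2 + σ) by ring, rpow_sub hr, rpow_add hr 1 p, rpow_one]
  ring

theorem lintegral_planeKernel_radialExterior_polar (p σ : ℝ) {a : ℝ → ℝ} (ha : Measurable a) :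
    ∫⁻ w in radialExterior a, ENNReal.ofReal (planeKernel p σ w) =
      ∫⁻ q in Ioi (0 : ℝ) ×ˢ Ioo (-π) π,
        {q : ℝ × ℝ | q.2 ∈ Ioo (-(π / 2)) (π / 2) ∧ a q.2 < q.1}.indicator
          (fun q => ENNReal.ofReal (cos q.2 ^ p * q.1 ^ (-1 - σ))) q := by
  rw [← lintegral_indicator (measurableSet_radialExterior ha),
    ← Complex.lintegral_comp_polarCoord_symm]
  refine setLIntegral_congr_fun (measurableSet_Ioi.prod measurableSet_Ioo) fun q hq => ?_
  have hmem := polarCoord_symm_mem_radialExterior_iff a hq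
  by_cases hqa : q.2 ∈ Ioo (-(π / 2)) (π / 2) ∧ a q.2 < q.1
  · have hcos : 0 < cos q.2 := cos_pos_of_mem_Ioo hqa.1
    simp only [indicator_of_mem (hmem.2 hqa)]
    rw [indicator_of_mem (mem_ofPred_eq ▸ hqa), smul_eq_mul, ← ENNReal.ofReal_mul hq.1.le,
      mul_planeKernel_polarCoord_symm p σ hq.1 hcos.le]
  · simp only [indicator_of_notMem (mt hmem.1 hqa), smul_zero]
    rw [indicator_of_notMem (mem_ofPred_eq ▸ hqa)]

theorem lintegral_Ioi_indicator_mul_rpow {σ b c : ℝ} (hσ : 0 < σ) (hb : 0 < b) (hc : 0 ≤ c) :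
    ∫⁻ r in Ioi 0, (Ioi b).indicator (fun r => ENNReal.ofReal (c * r ^ (-1 - σ))) r =
      ENNReal.ofReal (c * (b ^ (-σ) / σ)) := by
  simp_rw [ENNReal.ofReal_mul hc]
  rw [setLIntegral_indicator measurableSet_Ioi, inter_eq_left.2 (Ioi_subset_Ioi hb.le),
    lintegral_const_mul _ (by fun_prop), lintegral_Ioi_rpow (by linarith) hb,
    show -1 - σ + 1 = -σ by ring, neg_div_neg_eq]

theorem lintegral_planeKernel_radialExterior (p : ℝ) {σ : ℝ} (hσ : 0 < σ) {a : ℝ → ℝ}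
    (ha : Measurable a) (hpos : ∀ᵐ θ, 0 < a θ) :
    ∫⁻ w in radialExterior a, ENNReal.ofReal (planeKernel p σ w) =
      ∫⁻ θ in Ioo (-(π / 2)) (π / 2), ENNReal.ofReal (cos θ ^ p * (a θ ^ (-σ) / σ)) := by
  have hset : MeasurableSet {q : ℝ × ℝ | q.2 ∈ Ioo (-(π / 2)) (π / 2) ∧ a q.2 < q.1} :=
    (measurable_snd measurableSet_Ioo).inter
      (measurableSet_lt (ha.comp measurable_snd) measurable_fst)
  have hsub : Ioo (-(π / 2)) (π / 2) ⊆ Ioo (-π) π :=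
    Ioo_subset_Ioo (by linarith [pi_pos]) (by linarith [pi_pos])
  rw [lintegral_planeKernel_radialExterior_polar p σ ha, Measure.volume_eq_prod,
    setLIntegral_prod_symm _ (by fun_prop (disch := exact hset))]
  conv_rhs => rw [← inter_eq_left.2 hsub, ← setLIntegral_indicator measurableSet_Ioo]
  refine lintegral_congr_ae (ae_restrict_of_ae ?_)
  filter_upwards [hpos] with θ hθa
  by_cases hθ : θ ∈ Ioo (-(π / 2)) (π / 2)
  · rw [indicator_of_mem hθ,
      ← lintegral_Ioi_indicator_mul_rpow hσ hθa (rpow_nonneg (cos_pos_of_mem_Ioo hθ).le p)]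
    simp only [indicator, mem_ofPred_eq, hθ, true_and, mem_Ioi]
  · simp only [indicator, mem_ofPred_eq, hθ, false_and, if_false, lintegral_zero]

theorem setIntegral_planeKernel_radialExterior (p : ℝ) {σ : ℝ} (hσ : 0 < σ) {a : ℝ → ℝ}
    (ha : Measurable a) (hpos : ∀ᵐ θ, 0 < a θ) :
    ∫ w in radialExterior a, planeKernel p σ w =
      ∫ θ in Ioo (-(π / 2)) (π / 2), cos θ ^ p * (a θ ^ (-σ) / σ) := by
  rw [integral_eq_lintegral_of_nonneg_ae ?_ (measurable_planeKernel p σ).aestronglyMeasurable,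
    lintegral_planeKernel_radialExterior p hσ ha hpos,
    ← integral_eq_lintegral_of_nonneg_ae ?_ (by fun_prop)]
  · filter_upwards [ae_restrict_mem measurableSet_Ioo, ae_restrict_of_ae hpos] with θ hθ hθa
    have := cos_pos_of_mem_Ioo hθ
    simp only [Pi.zero_apply]
    positivity
  · filter_upwards [ae_restrict_mem (measurableSet_radialExterior ha)] with w hw
    exact planeKernel_nonneg p σ hw.1.le

theorem ae_sin_ne_zero : ∀ᵐ θ : ℝ, sin θ ≠ 0 := by
  have hcount : {θ : ℝ | sin θ = 0}.Countable := by
    refine (countable_range fun k : ℤ => k * π).mono fun θ hθ => ?_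
    exact sin_eq_zero_iff.1 hθ
  filter_upwards [hcount.ae_notMem volume] with θ hθ using hθ

theorem setIntegral_planeKernel_radialExterior_const {p σ δ : ℝ} (hp : -1 < p) (hσ : 0 < σ)
    (hδ : 0 < δ) :
    ∫ w in radialExterior fun _ => δ, planeKernel p σ w =
      ProbabilityTheory.beta (1 / 2) ((p + 1) / 2) * (δ ^ (-σ) / σ) := by
  rw [setIntegral_planeKernel_radialExterior p hσ measurable_const (ae_of_all _ fun _ => hδ),
    integral_mul_const,
    ← integral_abs_sin_rpow_mul_cos_rpow one_half_pos (by linarith : 0 < (p + 1) / 2)]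
  simp only [show 2 * (1 / 2 : ℝ) - 1 = 0 by norm_num, show 2 * ((p + 1) / 2) - 1 = p by ring,
    rpow_zero, one_mul]

theorem setIntegral_planeKernel_radialExterior_abs_sin {p σ r : ℝ} (hp : -1 < p) (hσ₀ : 0 < σ)
    (hσ₁ : σ < 1) (hr : 0 < r) :
    ∫ w in radialExterior fun θ => r * |sin θ|, planeKernel p σ w =
      ProbabilityTheory.beta ((1 - σ) / 2) ((p + 1) / 2) / (σ * r ^ σ) := by
  have hpos : ∀ᵐ θ : ℝ, 0 < r * |sin θ| := by
    filter_upwards [ae_sin_ne_zero] with θ hθ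
    positivity
  rw [setIntegral_planeKernel_radialExterior p hσ₀ (by fun_prop) hpos,
    ← integral_abs_sin_rpow_mul_cos_rpow (by linarith : 0 < (1 - σ) / 2)
      (by linarith : 0 < (p + 1) / 2), ← integral_div]
  refine integral_congr_ae (ae_of_all _ fun θ => ?_)
  simp only [mul_rpow hr.le (abs_nonneg _), rpow_neg hr.le]
  ring_nf

theorem mem_radialExterior_abs_sin_iff (r : ℝ) {w : ℂ} :
    w ∈ radialExterior (fun θ => r * |sin θ|) ↔ 0 < w.re ∧ r * |w.im| < ‖w‖ ^ 2 := by
  refine and_congr_right fun hw => ?_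
  have hnorm : 0 < ‖w‖ := norm_pos_iff.2 fun h => by simp [h] at hw
  change r * |sin w.arg| < ‖w‖ ↔ _
  rw [Complex.sin_arg, abs_div, abs_of_pos hnorm, ← mul_div_assoc, div_lt_iff₀ hnorm, sq]

theorem integrableOn_planeKernel_diff_ball {p σ ε : ℝ} (hp : -1 < p) (hσ : 0 < σ) (hε : 0 < ε) :
    IntegrableOn (planeKernel p σ) ({w : ℂ | 0 < w.re} \ ball 0 ε) := by
  have hint : IntegrableOn (planeKernel p σ) (radialExterior fun _ => ε / 2) := by
    refine Integrable.of_integral_ne_zero ?_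
    rw [setIntegral_planeKernel_radialExterior_const hp hσ (half_pos hε)]
    have := ProbabilityTheory.beta_pos one_half_pos (by linarith : 0 < (p + 1) / 2)
    positivity
  refine hint.mono_set fun w hw => ⟨hw.1, ?_⟩
  have : ε ≤ ‖w‖ := by simpa using hw.2
  linarith

theorem integrableOn_planeKernel_radialExterior_abs_sin {p σ r : ℝ} (hp : -1 < p) (hσ₀ : 0 < σ)
    (hσ₁ : σ < 1) (hr : 0 < r) :
    IntegrableOn (planeKernel p σ) (radialExterior fun θ => r * |sin θ|) := by
  refine Integrable.of_integral_ne_zero ?_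
  rw [setIntegral_planeKernel_radialExterior_abs_sin hp hσ₀ hσ₁ hr]
  have := ProbabilityTheory.beta_pos (by linarith : 0 < (1 - σ) / 2)
    (by linarith : 0 < (p + 1) / 2)
  positivity

end Polar

section PrincipalValue

open ComplexConjugate

/-- The function `χ̂` of a circle of radius `ρ`, in the coordinate `w = t + i h` centred at a point
of the circle, where `t` is the tangential and `h` the outward normal component: it is `1` in the
closed disc, `0` on the rest of the tangent line and `-1` elsewhere. -/
noncomputable def discSign (ρ : ℝ) (w : ℂ) : ℝ :=
  if ‖w‖ ^ 2 + 2 * ρ * w.im ≤ 0 then 1 else if w.im = 0 then 0 else -1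

theorem measurable_discSign (ρ : ℝ) : Measurable (discSign ρ) := by
  refine Measurable.ite (measurableSet_le ?_ measurable_const) measurable_const
    (Measurable.ite (measurableSet_eq_fun Complex.measurable_im measurable_const)
      measurable_const measurable_const)
  exact (measurable_norm.pow_const 2).add (Complex.measurable_im.const_mul (2 * ρ))

theorem norm_discSign_le_one (ρ : ℝ) (w : ℂ) : ‖discSign ρ w‖ ≤ 1 := by
  unfold discSign
  split_ifs <;> simp

theorem discSign_add_discSign_conj {ρ : ℝ} (hρ : 0 ≤ ρ) {w : ℂ} (hw : w.im ≠ 0) :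
    discSign ρ w + discSign ρ (conj w) = if 2 * ρ * |w.im| < ‖w‖ ^ 2 then -2 else 0 := by
  have hnorm : 0 < ‖w‖ ^ 2 := by
    have : w ≠ 0 := fun h => hw (by simp [h])
    positivity
  have hρw : 0 ≤ ρ * |w.im| := by positivity
  simp only [discSign, Complex.conj_im, Complex.norm_conj, neg_eq_zero, hw, if_false]
  rcases abs_choice w.im with habs | habs <;> rw [habs] at hρw ⊢ <;> grind

theorem two_mul_setIntegral_eq_of_conj_invariant {f : ℂ → ℝ} {s : Set ℂ} (hf : IntegrableOn f s)
    (hs : conj ⁻¹' s = s) :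
    2 * ∫ w in s, f w = ∫ w in s, f w + f (conj w) := by
  have hmp : MeasurePreserving (conj : ℂ → ℂ) := Complex.conjLIE.measurePreserving
  have hemb : MeasurableEmbedding (conj : ℂ → ℂ) :=
    Complex.conjLIE.toHomeomorph.measurableEmbedding
  have hint : IntegrableOn (fun w => f (conj w)) s := by
    have := (hmp.integrableOn_comp_preimage hemb (f := f) (s := s)).2 hf
    rwa [hs] at this
  have heq := hmp.setIntegral_preimage_emb hemb f s
  rw [hs] at heq
  rw [integral_add hf hint, heq, two_mul]

theorem ae_im_ne_zero : ∀ᵐ w : ℂ, w.im ≠ 0 := by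
  have hker : volume (LinearMap.ker Complex.imLm : Set ℂ) = 0 := by
    refine Measure.addHaar_submodule _ _ fun h => ?_
    have : Complex.I ∈ LinearMap.ker Complex.imLm := h ▸ Submodule.mem_top
    simp at this
  refine measure_mono_null (fun w hw => ?_) hker
  simpa using hw

theorem integrableOn_planeKernel_mul_discSign {p σ ε : ℝ} (hp : -1 < p) (hσ : 0 < σ)
    (hε : 0 < ε) (ρ : ℝ) :
    IntegrableOn (fun w => planeKernel p σ w * discSign ρ w) ({w : ℂ | 0 < w.re} \ ball 0 ε) :=
  (integrableOn_planeKernel_diff_ball hp hσ hε).mul_bdd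
    (measurable_discSign ρ).aestronglyMeasurable (ae_of_all _ (norm_discSign_le_one ρ))

theorem planeKernel_mul_discSign_add_conj (p σ : ℝ) {ρ : ℝ} (hρ : 0 ≤ ρ) {w : ℂ} (hre : 0 < w.re)
    (him : w.im ≠ 0) :
    planeKernel p σ w * discSign ρ w + planeKernel p σ (conj w) * discSign ρ (conj w) =
      -2 * (radialExterior fun θ => 2 * ρ * |Real.sin θ|).indicator (planeKernel p σ) w := by
  classical
  have hker : planeKernel p σ (conj w) = planeKernel p σ w := by
    simp only [planeKernel, Complex.conj_re, Complex.norm_conj]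
  rw [hker, ← mul_add, discSign_add_discSign_conj hρ him, indicator_apply]
  simp only [mem_radialExterior_abs_sin_iff, hre, true_and]
  split_ifs <;> ring

theorem setIntegral_planeKernel_mul_discSign {p σ ρ ε : ℝ} (hp : -1 < p) (hσ : 0 < σ)
    (hρ : 0 ≤ ρ) (hε : 0 < ε) :
    ∫ w in {w : ℂ | 0 < w.re} \ ball 0 ε, planeKernel p σ w * discSign ρ w =
      -∫ w in (radialExterior fun θ => 2 * ρ * |Real.sin θ|) \ ball 0 ε, planeKernel p σ w := by
  set s := {w : ℂ | 0 < w.re} \ ball 0 ε with hs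
  set X := radialExterior fun θ => 2 * ρ * |Real.sin θ|
  have hs_meas : MeasurableSet s :=
    (measurableSet_lt measurable_const Complex.measurable_re).diff measurableSet_ball
  have hX_meas : MeasurableSet X := measurableSet_radialExterior (by fun_prop)
  have hs_conj : conj ⁻¹' s = s := by
    ext w
    simp [hs]
  have hsX : s ∩ X = X \ ball 0 ε := by
    rw [hs, inter_comm, ← inter_sdiff_assoc, inter_eq_left.2 fun w hw => hw.1]
  have hfold : ∫ w in s, planeKernel p σ w * discSign ρ w +
      planeKernel p σ (conj w) * discSign ρ (conj w) =
      ∫ w in s, -2 * X.indicator (planeKernel p σ) w := by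
    refine setIntegral_congr_ae hs_meas ?_
    filter_upwards [ae_im_ne_zero] with w him hw
    exact planeKernel_mul_discSign_add_conj p σ hρ hw.1 him
  rw [← two_mul_setIntegral_eq_of_conj_invariant
    (integrableOn_planeKernel_mul_discSign hp hσ hε ρ) hs_conj, integral_const_mul,
    setIntegral_indicator hX_meas, hsX] at hfold
  linarith

theorem tendsto_setIntegral_diff_ball {X E : Type*} [MetricSpace X] [MeasurableSpace X]
    [OpensMeasurableSpace X] [NormedAddCommGroup E] [NormedSpace ℝ E] {μ : Measure X}
    [NullSingletonClass μ] {f : X → E} {s : Set X} (hf : IntegrableOn f s μ) (x : X) :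
    Tendsto (fun ε => ∫ y in s \ ball x ε, f y ∂μ) (𝓝[>] 0) (𝓝 (∫ y in s, f y ∂μ)) := by
  have hcover : AECover (μ.restrict s) (𝓝[>] (0 : ℝ)) fun ε => (ball x ε)ᶜ := by
    refine ⟨?_, fun ε => measurableSet_ball.compl⟩
    filter_upwards [ae_restrict_of_ae (measure_eq_zero_iff_ae_notMem.1 (measure_singleton x))]
      with y hy
    filter_upwards [nhdsWithin_le_nhds (Iio_mem_nhds (dist_pos.2 hy))] with ε hε
    exact fun h => (mem_ball.1 h).not_gt hε
  refine (hcover.integral_tendsto_of_countably_generated hf).congr fun ε => ?_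
  rw [Measure.restrict_restrict measurableSet_ball.compl, sdiff_eq, inter_comm]

theorem tendsto_setIntegral_planeKernel_mul_discSign {p σ ρ : ℝ} (hp : -1 < p) (hσ₀ : 0 < σ)
    (hσ₁ : σ < 1) (hρ : 0 < ρ) :
    Tendsto (fun ε => ∫ w in {w : ℂ | 0 < w.re} \ ball 0 ε, planeKernel p σ w * discSign ρ w)
      (𝓝[>] 0)
      (𝓝 (-(ProbabilityTheory.beta ((1 - σ) / 2) ((p + 1) / 2) / (σ * (2 * ρ) ^ σ)))) := by
  have hρ₂ : 0 < 2 * ρ := by positivity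
  rw [← setIntegral_planeKernel_radialExterior_abs_sin hp hσ₀ hσ₁ hρ₂]
  refine (tendsto_setIntegral_diff_ball
    (integrableOn_planeKernel_radialExterior_abs_sin hp hσ₀ hσ₁ hρ₂) 0).neg.congr' ?_
  filter_upwards [self_mem_nhdsWithin] with ε hε
  exact (setIntegral_planeKernel_mul_discSign hp hσ₀ hρ.le hε).symm

end PrincipalValue

section Crossing

variable {E : Type*} [NormedAddCommGroup E] [InnerProductSpace ℝ E]

theorem add_smul_mem_sphere_iff {c z v : E} {ρ : ℝ} (hz : z ∈ sphere c ρ) {s : ℝ} (hs : s ≠ 0) :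
    z + s • v ∈ sphere c ρ ↔ s * ‖v‖ ^ 2 = -2 * ⟪z - c, v⟫ := by
  rw [mem_sphere_iff_norm] at hz ⊢
  have hexpand : ‖z + s • v - c‖ ^ 2 = ρ ^ 2 + s * (2 * ⟪z - c, v⟫ + s * ‖v‖ ^ 2) := by
    rw [add_sub_right_comm, norm_add_sq_real, real_inner_smul_right, norm_smul, hz, mul_pow,
      Real.norm_eq_abs, sq_abs]
    ring
  rw [← sq_eq_sq₀ (norm_nonneg _) (hz ▸ norm_nonneg _), hexpand, add_eq_left,
    mul_eq_zero_iff_left hs, neg_mul, eq_neg_iff_add_eq_zero, add_comm]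

theorem openSegment_add_eq_image (z v : E) :
    openSegment ℝ z (z + v) = (fun s : ℝ => z + s • v) '' Ioo 0 1 := by
  rw [openSegment_eq_image', add_sub_cancel_left]

theorem openSegment_inter_sphere_eq_singleton {c z v : E} {ρ : ℝ} (hz : z ∈ sphere c ρ)
    (hneg : ⟪z - c, v⟫ < 0) (hpos : 0 < ‖v‖ ^ 2 + 2 * ⟪z - c, v⟫) :
    openSegment ℝ z (z + v) ∩ sphere c ρ = {z + (-2 * ⟪z - c, v⟫ / ‖v‖ ^ 2) • v} := by
  have hv : 0 < ‖v‖ ^ 2 := by linarith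
  rw [openSegment_add_eq_image]
  ext x
  simp only [mem_inter_iff, mem_image, mem_singleton_iff]
  constructor
  · rintro ⟨⟨s, hs, rfl⟩, hx⟩
    rw [← (add_smul_mem_sphere_iff hz hs.1.ne').1 hx, mul_div_cancel_right₀ _ hv.ne']
  · rintro rfl
    have hs : 0 < -2 * ⟪z - c, v⟫ / ‖v‖ ^ 2 := div_pos (by linarith) hv
    refine ⟨⟨_, ⟨hs, (div_lt_one hv).2 (by linarith)⟩, rfl⟩, ?_⟩
    rw [add_smul_mem_sphere_iff hz hs.ne', div_mul_cancel₀ _ hv.ne']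

theorem openSegment_inter_sphere_eq_empty {c z v : E} {ρ : ℝ} (hz : z ∈ sphere c ρ) (hv : v ≠ 0)
    (h : ¬(⟪z - c, v⟫ < 0 ∧ 0 < ‖v‖ ^ 2 + 2 * ⟪z - c, v⟫)) :
    openSegment ℝ z (z + v) ∩ sphere c ρ = ∅ := by
  have hv₂ : 0 < ‖v‖ ^ 2 := by positivity
  rw [openSegment_add_eq_image, eq_empty_iff_forall_notMem]
  rintro _ ⟨⟨s, ⟨hs₀, hs₁⟩, rfl⟩, hx⟩
  have hs := (add_smul_mem_sphere_iff hz hs₀.ne').1 hx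
  have hlow : 0 < s * ‖v‖ ^ 2 := mul_pos hs₀ hv₂
  have hupp : s * ‖v‖ ^ 2 < ‖v‖ ^ 2 := mul_lt_of_lt_one_left hv₂ hs₁
  exact h ⟨by linarith, by linarith⟩

variable {n : ℕ}

theorem mem_oddCrossing_sphere_iff {c z v : EuclideanSpace ℝ (Fin n)} {ρ : ℝ}
    (hz : z ∈ sphere c ρ) (hv : v ≠ 0) :
    (z, z + v) ∈ oddCrossing (sphere c ρ) ↔ ⟪z - c, v⟫ < 0 ∧ 0 < ‖v‖ ^ 2 + 2 * ⟪z - c, v⟫ := by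
  simp only [oddCrossing, mem_ofPred_eq]
  by_cases h : ⟪z - c, v⟫ < 0 ∧ 0 < ‖v‖ ^ 2 + 2 * ⟪z - c, v⟫
  · simp [openSegment_inter_sphere_eq_singleton hz h.1 h.2, h]
  · simp [openSegment_inter_sphere_eq_empty hz hv h, h]

theorem chiHat_sphere_add {c z v : EuclideanSpace ℝ (Fin n)} {ρ : ℝ} (hρ : 0 < ρ)
    (hz : z ∈ sphere c ρ) (hv : v ≠ 0) :
    chiHat (sphere c ρ) (sphereNormal c ρ) z (z + v) =
      if ‖v‖ ^ 2 + 2 * ⟪z - c, v⟫ ≤ 0 then 1 else if ⟪z - c, v⟫ = 0 then 0 else -1 := by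
  have hinner : ⟪z - (z + v), sphereNormal c ρ z⟫ = ρ⁻¹ * -⟪z - c, v⟫ := by
    rw [sphereNormal, real_inner_smul_right, sub_add_cancel_left, inner_neg_left, real_inner_comm]
  have hpos : 0 < ρ⁻¹ * -⟪z - c, v⟫ ↔ ⟪z - c, v⟫ < 0 := by
    rw [mul_pos_iff_of_pos_left (inv_pos.2 hρ), neg_pos]
  have hneg : ρ⁻¹ * -⟪z - c, v⟫ < 0 ↔ 0 < ⟪z - c, v⟫ := by
    rw [mul_neg, neg_lt_zero, mul_pos_iff_of_pos_left (inv_pos.2 hρ)]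
  have hv₂ : 0 < ‖v‖ ^ 2 := by positivity
  simp only [chiHat, interiorSet, exteriorSet, mem_ofPred_eq, hinner, hpos, hneg,
    mem_oddCrossing_sphere_iff hz hv]
  grind

end Crossing

section Plane

variable {E : Type*} [NormedAddCommGroup E] [InnerProductSpace ℝ E]

/-- The parametrization `t + i h ↦ z + t e + h u` of the plane through `z` spanned by `e` and `u`,
which carries the half-plane integrals over to `ℂ`. -/
def planeMap (z e u : E) (w : ℂ) : E := z + w.re • e + w.im • u

theorem planeMap_sub_left (z e u : E) (w : ℂ) : planeMap z e u w - z = w.re • e + w.im • u := by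
  rw [planeMap, add_assoc, add_sub_cancel_left]

theorem norm_re_smul_add_im_smul {e u : E} (he : ‖e‖ = 1) (hu : ‖u‖ = 1) (heu : ⟪e, u⟫ = 0)
    (w : ℂ) : ‖w.re • e + w.im • u‖ = ‖w‖ := by
  rw [← sq_eq_sq₀ (norm_nonneg _) (norm_nonneg _), norm_add_sq_real, real_inner_smul_left,
    real_inner_smul_right, heu, norm_smul, norm_smul, he, hu, Complex.sq_norm,
    Complex.normSq_apply]
  simp only [mul_one, mul_zero, add_zero, Real.norm_eq_abs, sq_abs]
  ring

theorem isometry_planeMap (z : E) {e u : E} (he : ‖e‖ = 1) (hu : ‖u‖ = 1) (heu : ⟪e, u⟫ = 0) :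
    Isometry (planeMap z e u) := by
  refine Isometry.of_dist_eq fun v w => ?_
  rw [dist_eq_norm, dist_eq_norm, ← norm_re_smul_add_im_smul he hu heu (v - w)]
  congr 1
  simp only [planeMap, Complex.sub_re, Complex.sub_im]
  module

theorem map_planeMap_volume [MeasurableSpace E] [BorelSpace E] (z : E) {e u : E} (he : ‖e‖ = 1)
    (hu : ‖u‖ = 1) (heu : ⟪e, u⟫ = 0) :
    (volume : Measure ℂ).map (planeMap z e u) =
      (Measure.euclideanHausdorffMeasure 2).restrict (range (planeMap z e u)) := by
  rw [← (isometry_planeMap z he hu heu).map_euclideanHausdorffMeasure,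
    ← InnerProductSpace.euclideanHausdorffMeasure_eq_volume, Complex.finrank_real_complex]

end Plane

section Directional

variable {n : ℕ}

theorem norm_sphereNormal {c z : EuclideanSpace ℝ (Fin n)} {ρ : ℝ} (hρ : 0 < ρ)
    (hz : z ∈ sphere c ρ) : ‖sphereNormal c ρ z‖ = 1 := by
  rw [sphereNormal, norm_smul, mem_sphere_iff_norm.1 hz, norm_inv, Real.norm_of_nonneg hρ.le,
    inv_mul_cancel₀ hρ.ne']

theorem norm_sub_lineProj_planeMap (z : EuclideanSpace ℝ (Fin n)) {e u : EuclideanSpace ℝ (Fin n)}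
    (he : ‖e‖ = 1) (heu : ⟪e, u⟫ = 0) (w : ℂ) :
    ‖z - lineProj z e (planeMap z e u w)‖ = |w.re| := by
  rw [lineProj, planeMap_sub_left, Submodule.starProjection_unit_singleton ℝ he, inner_add_right,
    real_inner_smul_right, real_inner_smul_right, heu, real_inner_self_eq_norm_sq, he,
    sub_add_cancel_left, norm_neg, norm_smul, he]
  simp

theorem chiHat_sphere_planeMap {c z e : EuclideanSpace ℝ (Fin n)} {ρ : ℝ} (hρ : 0 < ρ)
    (hz : z ∈ sphere c ρ) (he : ‖e‖ = 1) (heu : ⟪e, sphereNormal c ρ z⟫ = 0) {w : ℂ}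
    (hw : w ≠ 0) :
    chiHat (sphere c ρ) (sphereNormal c ρ) z (planeMap z e (sphereNormal c ρ z) w) =
      discSign ρ w := by
  set u := sphereNormal c ρ z with hu
  have hu₁ : ‖u‖ = 1 := norm_sphereNormal hρ hz
  have hnorm := norm_re_smul_add_im_smul he hu₁ heu w
  have hv : w.re • e + w.im • u ≠ 0 := by rwa [← norm_ne_zero_iff, hnorm, norm_ne_zero_iff]
  have hinner : ⟪z - c, w.re • e + w.im • u⟫ = ρ * w.im := by
    rw [← smul_inv_smul₀ hρ.ne' (z - c), ← sphereNormal, ← hu, real_inner_smul_left,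
      inner_add_right, real_inner_smul_right, real_inner_smul_right, real_inner_comm, heu,
      real_inner_self_eq_norm_sq, hu₁]
    ring
  rw [planeMap, add_assoc, chiHat_sphere_add hρ hz hv, hinner, hnorm]
  simp only [discSign, mul_eq_zero, hρ.ne', false_or, mul_assoc]

theorem directionalIntegrand_sphere_planeMap {c z e : EuclideanSpace ℝ (Fin n)} {ρ : ℝ} (σ : ℝ)
    (hρ : 0 < ρ) (hz : z ∈ sphere c ρ) (he : ‖e‖ = 1) (heu : ⟪e, sphereNormal c ρ z⟫ = 0)
    {w : ℂ} (hw : 0 < w.re) :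
    directionalIntegrand (sphere c ρ) (sphereNormal c ρ) σ z e
        (planeMap z e (sphereNormal c ρ z) w) =
      planeKernel ((n : ℝ) - 2) σ w * discSign ρ w := by
  have hw₀ : w ≠ 0 := fun h => by simp [h] at hw
  rw [directionalIntegrand, norm_sub_lineProj_planeMap z he heu, abs_of_pos hw,
    chiHat_sphere_planeMap hρ hz he heu hw₀, norm_sub_rev, planeMap_sub_left,
    norm_re_smul_add_im_smul he (norm_sphereNormal hρ hz) heu, planeKernel, sub_add_cancel]
  ring

theorem halfPlane_eq_image_planeMap (ν : EuclideanSpace ℝ (Fin n) → EuclideanSpace ℝ (Fin n))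
    (z e : EuclideanSpace ℝ (Fin n)) :
    halfPlane ν z e = planeMap z e (ν z) '' {w | 0 < w.re} := by
  ext y
  constructor
  · rintro ⟨t, h, ht, rfl⟩
    exact ⟨⟨t, h⟩, ht, rfl⟩
  · rintro ⟨w, hw, rfl⟩
    exact ⟨w.re, w.im, hw, rfl⟩

section HalfPlane

variable {ν : EuclideanSpace ℝ (Fin n) → EuclideanSpace ℝ (Fin n)}
  {z e : EuclideanSpace ℝ (Fin n)}

theorem planeMap_preimage_halfPlane_diff_ball (he : ‖e‖ = 1) (hν : ‖ν z‖ = 1)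
    (heν : ⟪e, ν z⟫ = 0) (ε : ℝ) :
    planeMap z e (ν z) ⁻¹' (halfPlane ν z e \ ball z ε) = {w | 0 < w.re} \ ball 0 ε := by
  have hiso := isometry_planeMap z he hν heν
  have hz : planeMap z e (ν z) 0 = z := by simp [planeMap]
  have hball := hiso.preimage_ball 0 ε
  rw [hz] at hball
  rw [preimage_sdiff, halfPlane_eq_image_planeMap, hiso.injective.preimage_image, hball]

theorem restrict_euclideanHausdorffMeasure_halfPlane_diff_ball (he : ‖e‖ = 1) (hν : ‖ν z‖ = 1)
    (heν : ⟪e, ν z⟫ = 0) (ε : ℝ) :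
    (Measure.euclideanHausdorffMeasure 2).restrict (halfPlane ν z e \ ball z ε) =
      ((volume : Measure ℂ).map (planeMap z e (ν z))).restrict (halfPlane ν z e \ ball z ε) := by
  rw [map_planeMap_volume z he hν heν, Measure.restrict_restrict_of_subset]
  rw [halfPlane_eq_image_planeMap]
  exact sdiff_subset.trans (image_subset_range _ _)

end HalfPlane

theorem hasNonlocalDirectionalCurvature_sphere (hn : 2 ≤ n) {σ : ℝ} (hσ₀ : 0 < σ) (hσ₁ : σ < 1)
    {ρ : ℝ} (hρ : 0 < ρ) {c z e : EuclideanSpace ℝ (Fin n)} (hz : z ∈ sphere c ρ)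
    (het : e ∈ tangentSpace (sphereNormal c ρ) z) (he : ‖e‖ = 1) :
    HasNonlocalDirectionalCurvature (sphere c ρ) (sphereNormal c ρ) σ z e
      (-(ProbabilityTheory.beta ((1 - σ) / 2) (((n : ℝ) - 1) / 2) / (σ * (2 * ρ) ^ σ))) := by
  have hν := norm_sphereNormal hρ hz
  have heν : ⟪e, sphereNormal c ρ z⟫ = 0 :=
    Submodule.mem_orthogonal_singleton_iff_inner_left.1 het
  have hp : -1 < (n : ℝ) - 2 := by
    have : (2 : ℝ) ≤ n := by exact_mod_cast hn
    linarith
  have hemb : MeasurableEmbedding (planeMap z e (sphereNormal c ρ z)) :=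
    (isometry_planeMap z he hν heν).isClosedEmbedding.measurableEmbedding
  have hmeas (ε : ℝ) : MeasurableSet ({w : ℂ | 0 < w.re} \ ball 0 ε) :=
    (measurableSet_lt measurable_const Complex.measurable_re).diff measurableSet_ball
  have hcongr (ε : ℝ) : EqOn (directionalIntegrand (sphere c ρ) (sphereNormal c ρ) σ z e ∘
      planeMap z e (sphereNormal c ρ z)) (fun w => planeKernel ((n : ℝ) - 2) σ w * discSign ρ w)
      ({w : ℂ | 0 < w.re} \ ball 0 ε) :=
    fun w hw => directionalIntegrand_sphere_planeMap σ hρ hz he heν hw.1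
  constructor
  · intro ε hε
    rw [IntegrableOn, restrict_euclideanHausdorffMeasure_halfPlane_diff_ball he hν heν,
      ← IntegrableOn, hemb.integrableOn_map_iff, planeMap_preimage_halfPlane_diff_ball he hν heν,
      integrableOn_congr_fun (hcongr ε) (hmeas ε)]
    exact integrableOn_planeKernel_mul_discSign hp hσ₀ hε ρ
  · have hlim := tendsto_setIntegral_planeKernel_mul_discSign hp hσ₀ hσ₁ hρ
    rw [show (n : ℝ) - 2 + 1 = n - 1 by ring] at hlim
    refine hlim.congr fun ε => ?_
    rw [truncatedDirectionalCurvature,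
      restrict_euclideanHausdorffMeasure_halfPlane_diff_ball he hν heν, hemb.setIntegral_map,
      planeMap_preimage_halfPlane_diff_ball he hν heν]
    exact (setIntegral_congr_fun (hmeas ε) (hcongr ε)).symm

end Directional

section Moments

variable {F G : Type*} [NormedAddCommGroup F] [InnerProductSpace ℝ F] [NormedAddCommGroup G]
  [InnerProductSpace ℝ G]

/-- The map induced by a linear isometry on unit spheres; it is used to transport the surface
measure. -/
def sphereMap (U : F ≃ₗᵢ[ℝ] G) (e : sphere (0 : F) 1) : sphere (0 : G) 1 :=
  ⟨U e, by simp⟩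

theorem image_val_preimage_sphereMap (U : F ≃ₗᵢ[ℝ] G) (s : Set (sphere (0 : G) 1)) :
    Subtype.val '' (sphereMap U ⁻¹' s) = U.symm '' (Subtype.val '' s) := by
  ext x
  constructor
  · rintro ⟨e, he, rfl⟩
    exact ⟨_, ⟨_, he, rfl⟩, U.symm_apply_apply _⟩
  · rintro ⟨_, ⟨e, he, rfl⟩, rfl⟩
    refine ⟨sphereMap U.symm e, ?_, rfl⟩
    have : sphereMap U (sphereMap U.symm e) = e := Subtype.ext (U.apply_symm_apply _)
    rwa [mem_preimage, this]

theorem continuous_rankOne_sphere : Continuous fun e : sphere (0 : F) 1 =>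
    InnerProductSpace.rankOne ℝ (e : F) (e : F) :=
  (InnerProductSpace.rankOne ℝ (E := F) (F := F)).continuous₂.comp
    (continuous_subtype_val.prodMk continuous_subtype_val)

variable [FiniteDimensional ℝ F] [MeasurableSpace F] [BorelSpace F]

instance : IsFiniteMeasure (unitSphereMeasure F) :=
  inferInstanceAs (IsFiniteMeasure (volume : Measure F).toSphere)

open scoped Pointwise in
theorem measurePreserving_sphereMap [FiniteDimensional ℝ G] [MeasurableSpace G] [BorelSpace G]
    (U : F ≃ₗᵢ[ℝ] G) :
    MeasurePreserving (sphereMap U) (unitSphereMeasure F) (unitSphereMeasure G) := by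
  have hmeas : Measurable (sphereMap U) :=
    Measurable.subtype_mk (U.continuous.measurable.comp measurable_subtype_coe)
  refine ⟨hmeas, Measure.ext fun s hs => ?_⟩
  have hcone : Ioo (0 : ℝ) 1 • (Subtype.val '' (sphereMap U ⁻¹' s)) =
      U ⁻¹' (Ioo (0 : ℝ) 1 • (Subtype.val '' s)) := by
    rw [image_val_preimage_sphereMap]
    exact (image_image2_distrib_right fun r x => map_smul U.symm r x).symm.trans
      (U.symm.image_eq_preimage_symm _)
  rw [Measure.map_apply hmeas hs, unitSphereMeasure, unitSphereMeasure,
    Measure.toSphere_apply' _ (hmeas hs), Measure.toSphere_apply' _ hs, hcone,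
    U.measurePreserving.measure_preimage_emb U.toHomeomorph.measurableEmbedding,
    U.toLinearEquiv.finrank_eq]

theorem unitSphereMeasure_real_univ :
    (unitSphereMeasure F).real univ = omega (Module.finrank ℝ F) := by
  have hmp := measurePreserving_sphereMap (stdOrthonormalBasis ℝ F).repr
  rw [omega, ← hmp.map_eq, map_measureReal_apply hmp.measurable MeasurableSet.univ, preimage_univ]

theorem omega_pos {d : ℕ} (hd : 0 < d) : 0 < omega d := by
  have : Nonempty (Fin d) := ⟨⟨0, hd⟩⟩
  exact ENNReal.toReal_pos (Measure.measure_univ_ne_zero.2 (Measure.toSphere_ne_zero _))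
    (measure_ne_top _ _)

theorem integrable_unitSphereMeasure_of_continuous {H : Type*} [NormedAddCommGroup H]
    {f : sphere (0 : F) 1 → H} (hf : Continuous f) :
    Integrable f (unitSphereMeasure F) :=
  hf.integrable_of_hasCompactSupport (HasCompactSupport.of_compactSpace f)

theorem integrable_rankOne_sphere : Integrable (fun e : sphere (0 : F) 1 =>
    InnerProductSpace.rankOne ℝ (e : F) (e : F)) (unitSphereMeasure F) :=
  integrable_unitSphereMeasure_of_continuous continuous_rankOne_sphere

theorem integral_inner_sq_eq_of_norm_eq {u v : F} (h : ‖u‖ = ‖v‖) :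
    ∫ e : sphere (0 : F) 1, ⟪(e : F), u⟫ ^ 2 ∂unitSphereMeasure F =
      ∫ e : sphere (0 : F) 1, ⟪(e : F), v⟫ ^ 2 ∂unitSphereMeasure F := by
  set U := (Submodule.span ℝ {u - v})ᗮ.reflection
  have hU : U u = v := Submodule.reflection_sub h
  have hmp := measurePreserving_sphereMap U
  conv_rhs => rw [← hmp.map_eq]
  rw [integral_map hmp.aemeasurable (Continuous.aestronglyMeasurable (by fun_prop))]
  simp only [sphereMap, ← hU, LinearIsometryEquiv.inner_map_map]

theorem finrank_mul_integral_inner_sq (u : F) :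
    Module.finrank ℝ F * ∫ e : sphere (0 : F) 1, ⟪(e : F), u⟫ ^ 2 ∂unitSphereMeasure F =
      (unitSphereMeasure F).real univ * ‖u‖ ^ 2 := by
  let b := stdOrthonormalBasis ℝ F
  have hb (i) : ∫ e : sphere (0 : F) 1, ⟪(e : F), u⟫ ^ 2 ∂unitSphereMeasure F =
      ∫ e : sphere (0 : F) 1, ‖u‖ ^ 2 * ⟪b i, (e : F)⟫ ^ 2 ∂unitSphereMeasure F := by
    rw [integral_inner_sq_eq_of_norm_eq (v := ‖u‖ • b i) (by simp [norm_smul])]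
    simp only [real_inner_smul_right, mul_pow, real_inner_comm]
  calc Module.finrank ℝ F * ∫ e : sphere (0 : F) 1, ⟪(e : F), u⟫ ^ 2 ∂unitSphereMeasure F
      = ∑ i, ∫ e : sphere (0 : F) 1, ‖u‖ ^ 2 * ⟪b i, (e : F)⟫ ^ 2 ∂unitSphereMeasure F := by
        rw [← Finset.sum_congr rfl fun i _ => hb i]
        simp
    _ = ∫ e : sphere (0 : F) 1, ‖u‖ ^ 2 ∂unitSphereMeasure F := by
        rw [← integral_finsetSum _ fun i _ =>
          integrable_unitSphereMeasure_of_continuous (by fun_prop)]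
        simp [← Finset.mul_sum, OrthonormalBasis.sum_sq_inner_right]
    _ = (unitSphereMeasure F).real univ * ‖u‖ ^ 2 := by simp

theorem inner_integral_rankOne (u v : F) :
    ⟪(∫ e : sphere (0 : F) 1, InnerProductSpace.rankOne ℝ (e : F) (e : F)
        ∂unitSphereMeasure F) u, v⟫ =
      ∫ e : sphere (0 : F) 1, ⟪(e : F), u⟫ * ⟪(e : F), v⟫ ∂unitSphereMeasure F := by
  have hint := integrable_rankOne_sphere (F := F)
  rw [ContinuousLinearMap.integral_apply hint, real_inner_comm,
    ← integral_inner (hint.apply_continuousLinearMap u)]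
  simp only [InnerProductSpace.rankOne_apply, real_inner_smul_right, real_inner_comm v]

theorem finrank_smul_integral_rankOne :
    (Module.finrank ℝ F : ℝ) • ∫ e : sphere (0 : F) 1,
        InnerProductSpace.rankOne ℝ (e : F) (e : F) ∂unitSphereMeasure F =
      (unitSphereMeasure F).real univ • ContinuousLinearMap.id ℝ F := by
  set B := (Module.finrank ℝ F : ℝ) • (∫ e : sphere (0 : F) 1,
    InnerProductSpace.rankOne ℝ (e : F) (e : F) ∂unitSphereMeasure F) -
    (unitSphereMeasure F).real univ • ContinuousLinearMap.id ℝ F with hB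
  have hinner (u v : F) : ⟪B u, v⟫ = Module.finrank ℝ F *
      ∫ e : sphere (0 : F) 1, ⟪(e : F), u⟫ * ⟪(e : F), v⟫ ∂unitSphereMeasure F -
      (unitSphereMeasure F).real univ * ⟪u, v⟫ := by
    simp [hB, inner_sub_left, real_inner_smul_left, inner_integral_rankOne]
  have hsymm : (B : F →ₗ[ℝ] F).IsSymmetric := fun u v => by
    rw [ContinuousLinearMap.coe_coe, real_inner_comm (B v) u, hinner, hinner, real_inner_comm u v]
    simp_rw [mul_comm ⟪_, u⟫]
  refine sub_eq_zero.1 (ContinuousLinearMap.coe_injective ?_ : B = 0)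
  refine hsymm.inner_map_self_eq_zero.1 fun u => ?_
  simp only [ContinuousLinearMap.coe_coe, hinner, ← sq, finrank_mul_integral_inner_sq,
    real_inner_self_eq_norm_sq, sub_self]

theorem sphereIntegrable_const (a k : ℝ) : SphereIntegrable F a fun _ => k :=
  ((integrable_rankOne_sphere.smul a).sub (integrable_const _)).smul k

theorem finrank_smul_sphereIntegral_const (a k : ℝ) :
    (Module.finrank ℝ F : ℝ) • sphereIntegral F a (fun _ => k) =
      (k * (a - Module.finrank ℝ F) * omega (Module.finrank ℝ F)) •
        ContinuousLinearMap.id ℝ F := by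
  unfold sphereIntegral sphereIntegrand
  rw [integral_smul, integral_sub (integrable_rankOne_sphere.fun_smul a) (integrable_const _),
    integral_smul, integral_const, smul_comm, smul_sub, smul_comm _ a,
    finrank_smul_integral_rankOne, unitSphereMeasure_real_univ]
  module

end Moments

section Tensor

variable {n : ℕ} {S : Set (EuclideanSpace ℝ (Fin n))}
  {ν : EuclideanSpace ℝ (Fin n) → EuclideanSpace ℝ (Fin n)} {σ k : ℝ}
  {z : EuclideanSpace ℝ (Fin n)}

theorem finrank_tangentSpace_add_one (hν : ν z ≠ 0) :
    Module.finrank ℝ (tangentSpace ν z) + 1 = n := by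
  rw [add_comm, ← finrank_span_singleton (K := ℝ) hν, Submodule.finrank_add_finrank_orthogonal,
    finrank_euclideanSpace_fin]

theorem nonlocalCurvatureTensor_eq_smul_id (hn : 2 ≤ n) (hσ : 1 + σ ≠ 0) (hν : ν z ≠ 0)
    (hk : tangentialCurvature S ν σ z = fun _ => k) :
    nonlocalCurvatureTensor S ν σ z = k • ContinuousLinearMap.id ℝ (tangentSpace ν z) := by
  have hfinrank := Nat.eq_sub_of_add_eq (finrank_tangentSpace_add_one hν)
  have hcast : ((n - 1 : ℕ) : ℝ) = n - 1 := by rw [Nat.cast_sub (by lia), Nat.cast_one]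
  have hω : omega (n - 1) ≠ 0 := (omega_pos (by lia)).ne'
  have hmoment := finrank_smul_sphereIntegral_const (F := tangentSpace ν z) ((n : ℝ) + σ) k
  rw [hfinrank, hcast] at hmoment
  rw [nonlocalCurvatureTensor, hk, div_eq_inv_mul, mul_smul, hmoment, smul_smul]
  congr 1
  field_simp
  ring

end Tensor

end NonlocalCurvature

open NonlocalCurvature in
theorem mainTheorem3 (n : ℕ) (hn : 2 ≤ n) (σ : ℝ) (hσ₀ : 0 < σ) (hσ₁ : σ < 1)
    (ρ : ℝ) (hρ : 0 < ρ) (c z : EuclideanSpace ℝ (Fin n)) (hz : z ∈ Metric.sphere c ρ) :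
    (∀ e ∈ NonlocalCurvature.tangentSpace (NonlocalCurvature.sphereNormal c ρ) z, ‖e‖ = 1 →
      NonlocalCurvature.HasNonlocalDirectionalCurvature
          (Metric.sphere c ρ) (NonlocalCurvature.sphereNormal c ρ) σ z e
          (-(ProbabilityTheory.beta ((1 - σ) / 2) (((n : ℝ) - 1) / 2) / (σ * (2 * ρ) ^ σ))) ∧
      NonlocalCurvature.nonlocalDirectionalCurvature
          (Metric.sphere c ρ) (NonlocalCurvature.sphereNormal c ρ) σ z e =
        -(ProbabilityTheory.beta ((1 - σ) / 2) (((n : ℝ) - 1) / 2) / (σ * (2 * ρ) ^ σ))) ∧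
    NonlocalCurvature.TensorIntegrable
        (Metric.sphere c ρ) (NonlocalCurvature.sphereNormal c ρ) σ z ∧
    NonlocalCurvature.nonlocalCurvatureTensor
        (Metric.sphere c ρ) (NonlocalCurvature.sphereNormal c ρ) σ z =
      (-(ProbabilityTheory.beta ((1 - σ) / 2) (((n : ℝ) - 1) / 2) / (σ * (2 * ρ) ^ σ))) •
        ContinuousLinearMap.id ℝ
          (NonlocalCurvature.tangentSpace (NonlocalCurvature.sphereNormal c ρ) z) := by
  set k := -(ProbabilityTheory.beta ((1 - σ) / 2) (((n : ℝ) - 1) / 2) / (σ * (2 * ρ) ^ σ))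
  have hdir : ∀ e ∈ tangentSpace (sphereNormal c ρ) z, ‖e‖ = 1 →
      HasNonlocalDirectionalCurvature (sphere c ρ) (sphereNormal c ρ) σ z e k :=
    fun e het he => hasNonlocalDirectionalCurvature_sphere hn hσ₀ hσ₁ hρ hz het he
  have htan : tangentialCurvature (sphere c ρ) (sphereNormal c ρ) σ z = fun _ => k :=
    funext fun e => (hdir _ e.1.2 (norm_eq_of_mem_sphere e)).2.limUnder_eq
  have hν : sphereNormal c ρ z ≠ 0 := norm_ne_zero_iff.1 (by simp [norm_sphereNormal hρ hz])
  refine ⟨fun e het he => ⟨hdir e het he, (hdir e het he).2.limUnder_eq⟩, ?_,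
    nonlocalCurvatureTensor_eq_smul_id hn (by positivity) hν htan⟩
  rw [TensorIntegrable, htan]
  exact sphereIntegrable_const _ _
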